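/- For a non-empty finite word $r$ and a positive rational number $\beta$ such that $\beta|r|$ is an integer, let $r^{\beta}=rr\cdots rt$ be the word with $t$ a prefix of $r$ and $|r^{\beta}|/|r|=\beta$. A finite word is $\alpha$-power-free if it has no factor of the form $r^{\beta}$ with $r$ a non-empty word and $\beta\ge\alpha$ rational. Let $L_{k,\alpha}$ be the language of all finite $\alpha$-power-free words over an alphabet $\Sigma_k$ with $k$ letters, and let $e(L_{k,\alpha})\subseteq L_{k,\alpha}$ be the set of those words that are factors of some bi-infinite word over $\Sigma_k$ all of whose finite factors belong to $L_{k,\alpha}$. Corollary. Let $k\ge 3$ be an integer and let $\alpha\ge 5$ be a rational number. Then $L_{k,\alpha}$ has the Restivo–Salemi property (Shur's conjecture holds for it): for all $u,v\in e(L_{k,\alpha})$ there is a finite word $w$ over $\Sigma_k$ (possibly empty) such that $uwv\in e(L_{k,\alpha})$. -/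

import Mathlib

namespace PowerFree

/-- `IsPower r β p` says that the finite word `p` is the fractional power `r ^ β`, that is,
`p = r r ⋯ r t` with `t` a prefix of `r` and `|p| / |r| = β`, for a non-empty word `r` and a
positive rational `β`. -/
def IsPower {A : Type*} (r : List A) (β : ℚ) (p : List A) : Prop :=
  r ≠ [] ∧ 0 < β ∧ (p.length : ℚ) / (r.length : ℚ) = β ∧
    ∃ (n : ℕ) (t : List A), t <+: r ∧ p = (List.replicate n r).flatten ++ t

/-- The set of all pairs `(r, β)` such that `r ^ β` is a factor of the finite word `w`. -/
def powersIn {A : Type*} (w : List A) : Set (List A × ℚ) :=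
  {x | ∃ p : List A, IsPower x.1 x.2 p ∧ p <:+: w}

/-- `w` is `α`-power-free: it has no factor `r ^ β` with `β ≥ α`. -/
def IsPowerFree {A : Type*} (α : ℚ) (w : List A) : Prop :=
  {x ∈ powersIn w | α ≤ x.2} = ∅

/-- The language of all finite `α`-power-free words over the alphabet with `k` letters. -/
def powerFreeLanguage (k : ℕ) (α : ℚ) : Language (Fin k) :=
  {w : List (Fin k) | IsPowerFree α w}

/-- The set of all finite factors of a bi-infinite word `x : ℤ → A`. -/
def factors {A : Type*} (x : ℤ → A) : Set (List A) :=
  {w | ∃ i : ℤ, ∀ (j : ℕ) (hj : j < w.length), w[j] = x (i + (j : ℤ))}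

/-- The bi-infinite words all of whose finite factors belong to `L`. -/
def biInfinite {A : Type*} (L : Language A) : Set (ℤ → A) :=
  {x | ∀ w ∈ factors x, w ∈ L}

/-- The language `e(L)` of the words of `L` that can be extended to a bi-infinite word all of
whose finite factors belong to `L`. -/
def extendable {A : Type*} (L : Language A) : Language A :=
  {w : List A | w ∈ L ∧ ∃ x ∈ biInfinite L, w ∈ factors x}

/-- The Restivo-Salemi property of the language `L`. -/
def HasRestivoSalemiProperty {A : Type*} (L : Language A) : Prop :=
  ∀ u ∈ extendable L, ∀ v ∈ extendable L, ∃ w : List A, u ++ w ++ v ∈ extendable L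

end PowerFree

namespace PowerFree

/-! Take a bi-infinite `α`-power-free word `x` around `u`, keep a long block `[i, j]` containing
`u`, and replace each side by a Thue–Morse word on two letters. Each tail omits the block's end
letter on its side, so a repetition of period `p` meeting the block reaches fewer than `p` places
into it, and each tail starts with a letter other than the one it replaces. A power of exponent at
least 5 created this way has more than `4p` letters inside the block if it crosses one end, more
than `3p` if it crosses both. `exists_cut` picks `i` and `j` so that its period then predicts the
original letter of `x` just outside a crossed end; the changed letter breaks it.

Such cuts exist because ends of long runs with periods in `[P, 2P)` are at least `P + 3` apart
(`RunEndsAt.separated`), too sparse to fill a window. Far out in the tail, repetitions ending at a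
suitable place have exponent below 5/2, so the word for `u` and a mirrored one for `v` can be glued
(`glue_avoidsPowers`): crossing exponents stay below 5. -/

/-- `x` has period `p` on the integer interval `[a, b]`. -/
def PeriodicOn {A : Type*} (x : ℤ → A) (p a b : ℤ) : Prop :=
  ∀ n : ℤ, a ≤ n → n + p ≤ b → x n = x (n + p)

/-- No interval of length at least `α * p` of the bi-infinite word `x` has period `p`. -/
def AvoidsPowers {A : Type*} (α : ℚ) (x : ℤ → A) : Prop :=
  ∀ a b p : ℤ, 0 < p → α * p ≤ ((b - a + 1 : ℤ) : ℚ) → ¬ PeriodicOn x p a b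

/-! ### Fractional powers as periodic intervals -/

section Lists

variable {A : Type*}

theorem getElem?_flatten_replicate_append (r t : List A) (ht : t <+: r) (n i : ℕ)
    (hi : i < ((List.replicate n r).flatten ++ t).length) :
    ((List.replicate n r).flatten ++ t)[i]? = r[i % r.length]? := by
  induction n generalizing i with
  | zero =>
    simp only [List.replicate_zero, List.flatten_nil, List.nil_append] at hi ⊢
    rw [Nat.mod_eq_of_lt (lt_of_lt_of_le hi ht.length_le)]
    obtain ⟨s, rfl⟩ := ht
    rw [List.getElem?_append_left hi]
  | succ n ih =>
    rw [List.replicate_succ, List.flatten_cons, List.append_assoc] at hi ⊢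
    by_cases h : i < r.length
    · rw [List.getElem?_append_left h, Nat.mod_eq_of_lt h]
    · push Not at h
      rw [List.getElem?_append_right h, ih, ← Nat.mod_eq_sub_mod h]
      rw [List.length_append] at hi
      omega

theorem length_flatten_replicate (n : ℕ) (r : List A) :
    (List.replicate n r).flatten.length = n * r.length := by
  simp

theorem mem_biInfinite_iff (k : ℕ) (α : ℚ) (hα : 0 < α) (x : ℤ → Fin k) :
    x ∈ biInfinite (powerFreeLanguage k α) ↔ AvoidsPowers α x := by
  constructor
  · intro hx a b p hp hL hper
    have hLpos : 0 < b - a + 1 := by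
      have : (0 : ℚ) < ((b - a + 1 : ℤ) : ℚ) :=
        lt_of_lt_of_le (mul_pos hα (by exact_mod_cast hp)) hL
      exact_mod_cast this
    obtain ⟨q, rfl⟩ := Int.eq_ofNat_of_zero_le hp.le
    obtain ⟨L, hLe⟩ := Int.eq_ofNat_of_zero_le hLpos.le
    have hq : 0 < q := by omega
    have hxmod : ∀ i : ℕ, i < L → x (a + i) = x (a + (i % q : ℕ)) := by
      intro i
      induction i using Nat.strong_induction_on with
      | _ i ih =>
        intro hi
        by_cases h : i < q
        · rw [Nat.mod_eq_of_lt h]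
        · push Not at h
          rw [Nat.mod_eq_sub_mod h, ← ih (i - q) (by omega) (by omega)]
          rw [hper (a + (i - q : ℕ)) (by omega) (by omega)]
          congr 1
          omega
    let w : List (Fin k) := List.ofFn (fun n : Fin L => x (a + (n : ℕ)))
    let r : List (Fin k) := List.ofFn (fun n : Fin q => x (a + (n : ℕ)))
    have hr : r.length = q := by simp [r]
    have hw : w ∈ factors x := ⟨a, by intro j hj; simp [w]⟩
    have hfree : IsPowerFree α w := hx w hw
    have hmem : ((r, (L : ℚ) / q) : List (Fin k) × ℚ) ∈
        {x ∈ powersIn w | α ≤ x.2} := by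
      have hq' : (0 : ℚ) < q := by exact_mod_cast hq
      -- The whole window is the power: `L / q` full copies of its first `q` letters and a
      -- remainder.
      refine ⟨⟨w, ⟨?_, ?_, ?_, L / q, r.take (L % q), List.take_prefix _ _, ?_⟩,
        List.infix_refl _⟩, ?_⟩
      · intro h
        simp only at h
        rw [h] at hr
        simp at hr
        omega
      · have : (0 : ℚ) < L := by
          have : 0 < L := by omega
          exact_mod_cast this
        positivity
      · simp [w, r]
      · have hlen : ((List.replicate (L / q) r).flatten ++ r.take (L % q)).length = L := by
          rw [List.length_append, length_flatten_replicate, List.length_take, hr,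
            min_eq_left (Nat.mod_lt _ hq).le, mul_comm]
          exact Nat.div_add_mod L q
        apply List.ext_getElem?
        intro i
        by_cases hi : i < L
        · rw [getElem?_flatten_replicate_append _ _ (List.take_prefix _ _) _ _
            (by rw [hlen]; exact hi), hr]
          have := Nat.mod_lt i hq
          simp [w, r, hi, this]
          simpa using hxmod i hi
        · rw [List.getElem?_eq_none (by simp [w]; omega),
            List.getElem?_eq_none (by rw [hlen]; omega)]
      · rw [le_div_iff₀ hq']
        rw [hLe] at hL
        exact_mod_cast hL
    unfold IsPowerFree at hfree
    rw [hfree] at hmem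
    exact hmem
  · intro hx w hw
    change IsPowerFree α w
    unfold IsPowerFree
    rw [Set.eq_empty_iff_forall_notMem]
    rintro ⟨r, β⟩ ⟨⟨p, ⟨hr, hβ, hlen, n, t, ht, hp⟩, hpw⟩, hαβ⟩
    simp only at hr hβ hlen ht hp hαβ
    obtain ⟨i, hi⟩ := hw
    obtain ⟨s, s', rfl⟩ := hpw
    have hrpos : 0 < r.length := List.length_pos_iff.mpr hr
    have hval : ∀ m : ℕ, m < p.length → r[m % r.length]? = some (x (i + s.length + m)) := by
      intro m hm
      have h1 := hi (s.length + m) (by simp; omega)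
      rw [← getElem?_flatten_replicate_append r t ht n m (by rw [← hp]; exact hm), ← hp,
        List.getElem?_eq_getElem hm]
      congr 1
      have h2 : (s ++ p ++ s')[s.length + m]'(by simp; omega) = p[m] := by
        rw [List.getElem_append_left (by simp; omega), List.getElem_append_right (by omega)]
        simp
      rw [← h2, h1]
      congr 1
      push_cast
      ring
    refine hx (i + s.length) (i + s.length + p.length - 1) r.length (by omega) ?_ ?_
    · have hr' : (0 : ℚ) < r.length := by exact_mod_cast hrpos
      rw [← hlen, le_div_iff₀ hr'] at hαβ
      push_cast
      linarith
    · intro m hm1 hm2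
      obtain ⟨d, rfl⟩ : ∃ d : ℕ, m = i + s.length + d := ⟨(m - (i + s.length)).toNat, by omega⟩
      have h1 := hval d (by omega)
      have h2 := hval (d + r.length) (by omega)
      rw [Nat.add_mod_right, h1] at h2
      have h3 := Option.some.inj h2
      rw [h3]
      congr 1
      push_cast
      ring

end Lists

/-! ### Overlap-free tails from the Thue–Morse sequence -/

section ThueMorse

/-- The Thue–Morse sequence. -/
def thueMorse (n : ℕ) : Bool :=
  if h : n = 0 then false else (thueMorse (n / 2)) ^^ (n % 2 == 1)
termination_by n
decreasing_by omega

theorem thueMorse_zero : thueMorse 0 = false := by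
  rw [thueMorse]; simp

theorem thueMorse_two_mul (n : ℕ) : thueMorse (2 * n) = thueMorse n := by
  rcases Nat.eq_zero_or_pos n with rfl | h
  · rfl
  · rw [thueMorse, dif_neg (by omega)]
    simp

theorem thueMorse_two_mul_add_one (n : ℕ) : thueMorse (2 * n + 1) = !thueMorse n := by
  rw [thueMorse, dif_neg (by omega)]
  have h1 : (2 * n + 1) / 2 = n := by omega
  have h2 : (2 * n + 1) % 2 = 1 := by omega
  simp [h1, h2]

theorem thueMorse_succ_ne_of_even (n : ℕ) (h : n % 2 = 0) :
    thueMorse (n + 1) ≠ thueMorse n := by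
  obtain ⟨m, rfl⟩ : ∃ m, n = 2 * m := ⟨n / 2, by omega⟩
  rw [thueMorse_two_mul_add_one, thueMorse_two_mul]
  simp

theorem thueMorse_not_const (a : ℕ) :
    ¬ (thueMorse a = thueMorse (a + 1) ∧ thueMorse (a + 1) = thueMorse (a + 2)) := by
  rintro ⟨h1, h2⟩
  rcases Nat.mod_two_eq_zero_or_one a with h | h
  · exact thueMorse_succ_ne_of_even a h h1.symm
  · exact thueMorse_succ_ne_of_even (a + 1) (by omega) h2.symm

/-- Six alternating letters contain three equal ones at consecutive even positions; halving the
indices gives three equal adjacent letters. -/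
theorem thueMorse_not_alternating (a : ℕ)
    (h : ∀ i, i < 5 → thueMorse (a + i + 1) ≠ thueMorse (a + i)) : False := by
  have h2 : ∀ i, i < 4 → thueMorse (a + i + 2) = thueMorse (a + i) := by
    intro i hi
    have e1 := h i (by omega)
    have e2 := h (i + 1) (by omega)
    rw [show a + (i + 1) + 1 = a + i + 2 by ring, show a + (i + 1) = a + i + 1 by ring] at e2
    revert e1 e2
    cases thueMorse (a + i + 2) <;> cases thueMorse (a + i + 1) <;> cases thueMorse (a + i) <;> simp
  obtain ⟨m, d, hd, hm⟩ : ∃ m d, d < 2 ∧ a + d = 2 * m := ⟨(a + 1) / 2, a % 2, by omega, by omega⟩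
  have e1 := h2 d (by omega)
  have e2 := h2 (d + 2) (by omega)
  rw [show a + (d + 2) + 2 = 2 * (m + 2) by omega, show a + (d + 2) = 2 * (m + 1) by omega,
    thueMorse_two_mul, thueMorse_two_mul] at e2
  rw [show a + d + 2 = 2 * (m + 1) by omega, hm, thueMorse_two_mul, thueMorse_two_mul] at e1
  exact thueMorse_not_const m ⟨e1.symm, e2.symm⟩

/-- The Thue–Morse sequence is overlap-free. -/
theorem thueMorse_overlap_free (p : ℕ) (hp : 0 < p) (a : ℕ)
    (h : ∀ n, n ≤ p → thueMorse (a + n) = thueMorse (a + n + p)) : False := by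
  induction p using Nat.strong_induction_on generalizing a with
  | _ p ih =>
    rcases Nat.mod_two_eq_zero_or_one p with hpar | hpar
    · obtain ⟨q, rfl⟩ : ∃ q, p = 2 * q := ⟨p / 2, by omega⟩
      refine ih q (by omega) (by omega) (a / 2) fun n hn => ?_
      have h1 := h (2 * n) (by omega)
      rcases Nat.mod_two_eq_zero_or_one a with ha | ha
      · rw [show a + 2 * n + 2 * q = 2 * (a / 2 + n + q) by omega,
          show a + 2 * n = 2 * (a / 2 + n) by omega, thueMorse_two_mul, thueMorse_two_mul] at h1
        exact h1
      · rw [show a + 2 * n + 2 * q = 2 * (a / 2 + n + q) + 1 by omega,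
          show a + 2 * n = 2 * (a / 2 + n) + 1 by omega, thueMorse_two_mul_add_one,
          thueMorse_two_mul_add_one] at h1
        simpa using h1
    · by_cases hp1 : p = 1
      · subst hp1
        exact thueMorse_not_const a ⟨h 0 (by omega), h 1 (by omega)⟩
      -- An odd period flips parity, so each adjacent pair starting at an odd position is a copy of
      -- one starting at an even position, whose letters differ.
      · refine thueMorse_not_alternating a fun i hi => ?_
        rcases Nat.mod_two_eq_zero_or_one (a + i) with hai | hai
        · exact thueMorse_succ_ne_of_even _ hai
        · by_cases hip : i + 1 ≤ p
          · rw [h i (by omega), show a + i + 1 = a + (i + 1) by ring, h (i + 1) hip,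
              show a + (i + 1) + p = a + i + p + 1 by ring]
            exact thueMorse_succ_ne_of_even _ (by omega)
          · obtain ⟨d, rfl⟩ : ∃ d, i = d + p := ⟨i - p, by omega⟩
            have e1 := h d (by omega)
            have e2 := h (d + 1) (by omega)
            rw [show a + (d + p) + 1 = a + (d + 1) + p by ring,
              show a + (d + p) = a + d + p by ring, ← e1, ← e2]
            exact thueMorse_succ_ne_of_even (a + d) (by omega)

theorem exists_ne_ne {k : ℕ} (hk : 3 ≤ k) (a c : Fin k) : ∃ b : Fin k, b ≠ a ∧ b ≠ c := by
  by_contra! hall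
  have h1 := Finset.card_le_card (t := {a, c}) (s := (Finset.univ : Finset (Fin k)))
    (fun b _ => by
      by_cases h : b = a
      · simp [h]
      · simp [hall b h])
  have h2 := Finset.card_le_two (a := a) (b := c)
  rw [Finset.card_univ, Fintype.card_fin] at h1
  omega

/-- Over at least three letters there is an overlap-free infinite word with prescribed first
letter that avoids another given letter. -/
theorem exists_overlap_free {k : ℕ} (hk : 3 ≤ k) (a c : Fin k) (hac : a ≠ c) :
    ∃ τ : ℕ → Fin k, τ 0 = a ∧ (∀ n, τ n ≠ c) ∧
      ∀ p, 0 < p → ∀ s, ¬ ∀ n, n ≤ p → τ (s + n) = τ (s + n + p) := by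
  obtain ⟨b, hb⟩ := exists_ne_ne hk a c
  refine ⟨fun n => if thueMorse n then b else a, by simp [thueMorse_zero], ?_, ?_⟩
  · intro n
    dsimp only
    split_ifs
    · exact hb.2
    · exact hac
  · intro p hp s h
    refine thueMorse_overlap_free p hp s fun n hn => ?_
    have := h n hn
    dsimp only at this
    revert this
    cases thueMorse (s + n) <;> cases thueMorse (s + n + p) <;> simp [hb.1, Ne.symm hb.1]

end ThueMorse

/-! ### Ends of runs and the choice of cuts -/

section Runs

variable {A : Type*}

theorem PeriodicOn.mono {x : ℤ → A} {p a b a' b' : ℤ} (h : PeriodicOn x p a b)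
    (ha : a ≤ a') (hb : b' ≤ b) : PeriodicOn x p a' b' :=
  fun n h1 h2 => h n (by omega) (by omega)

theorem PeriodicOn.congr {x y : ℤ → A} {p a b : ℤ} (h : PeriodicOn x p a b) (hp : 0 ≤ p)
    (hxy : ∀ n, a ≤ n → n ≤ b → x n = y n) : PeriodicOn y p a b := by
  intro n h1 h2
  rw [← hxy n h1 (by omega), ← hxy (n + p) (by omega) h2]
  exact h n h1 h2

theorem PeriodicOn.reflect {x : ℤ → A} {p a b : ℤ} (c : ℤ) (h : PeriodicOn x p a b) :
    PeriodicOn (fun n => x (c - n)) p (c - b) (c - a) := by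
  intro n h1 h2
  have := h (c - (n + p)) (by omega) (by omega)
  rw [show c - (n + p) + p = c - n by ring] at this
  exact this.symm

/-- A maximal interval of period `p` and length more than `4 * p` ends at `e`. -/
def RunEndsAt (x : ℤ → A) (p e : ℤ) : Prop :=
  PeriodicOn x p (e - 4 * p) e ∧ x (e + 1) ≠ x (e + 1 - p)

/-- If the ends were closer, going back by `p'`, then `p`, then forward by `p'` from `e + 1` would
extend the first run. The overlap suffices because `3p' - p > P`. -/
theorem RunEndsAt.separated {x : ℤ → A} {P p p' e e' : ℤ} (hP : 0 < P) (hp : P ≤ p)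
    (hp2 : p < 2 * P) (hp' : P ≤ p') (hp2' : p' < 2 * P) (h : RunEndsAt x p e)
    (h' : RunEndsAt x p' e') (hlt : e < e') : P + 3 ≤ e' - e := by
  by_contra! hcon
  apply h.2
  have e1 := h'.1 (e + 1 - p') (by omega) (by omega)
  have e2 := h.1 (e + 1 - p' - p) (by omega) (by omega)
  have e3 := h'.1 (e + 1 - p' - p) (by omega) (by omega)
  rw [show e + 1 - p' + p' = e + 1 by ring] at e1
  rw [show e + 1 - p' - p + p = e + 1 - p' by ring] at e2
  rw [show e + 1 - p' - p + p' = e + 1 - p by ring] at e3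
  rw [← e1, ← e2, e3]

theorem card_le_of_separated (B : Finset ℤ) (m : ℤ) (n D : ℕ) (hD : 0 < D)
    (hB : ∀ e ∈ B, m ≤ e ∧ e < m + n)
    (hsep : ∀ e ∈ B, ∀ e' ∈ B, e < e' → (D : ℤ) ≤ e' - e) : B.card ≤ n / D + 1 := by
  have hDz : (0 : ℤ) < D := by exact_mod_cast hD
  have key : ∀ e ∈ B, ∀ e' ∈ B, e < e' → (e - m).toNat / D ≠ (e' - m).toNat / D := by
    intro e he e' he' hlt heq
    have h1 := hsep e he e' he' hlt
    have h2 := hB e he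
    have h3 := hB e' he'
    have h4 : (e - m).toNat + D ≤ (e' - m).toNat := by omega
    have h5 := Nat.div_le_div_right (c := D) h4
    rw [Nat.add_div_right _ hD] at h5
    omega
  calc B.card ≤ (Finset.range (n / D + 1)).card := by
        apply Finset.card_le_card_of_injOn (fun e => (e - m).toNat / D)
        · intro e he
          have := hB e he
          have h1 : (e - m).toNat ≤ n := by omega
          have := Nat.div_le_div_right (c := D) h1
          simp only [Finset.coe_range, Set.mem_Iio]
          omega
        · intro e he e' he' heq
          rcases lt_trichotomy e e' with h | h | h
          · exact absurd heq (key e he e' he' h)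
          · exact h
          · exact absurd heq.symm (key e' he' e he h)
    _ = n / D + 1 := by simp

theorem sum_two_pow_sub_le (n : ℕ) : ∑ s ∈ Finset.range n, 2 ^ (n - s) ≤ 2 * 2 ^ n := by
  induction n with
  | zero => simp
  | succ n ih =>
    rw [Finset.sum_range_succ']
    simp only [Nat.add_sub_add_right, Nat.sub_zero]
    rw [pow_succ]
    omega

/-- The `+ 3` is essential: it brings the four smallest scales down to weights 1/4, 1/5, 1/7, 1/11,
and the others add at most 1/8. -/
theorem sum_two_pow_div_le (n : ℕ) (hn : 2 ≤ n) :
    ∑ s ∈ Finset.range (n + 4), (2 ^ (n + 4) / (2 ^ s + 3) + 1) + 2 ≤ 2 ^ (n + 4) := by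
  have h1 : ∑ s ∈ Finset.range n, (2 ^ (n + 4) / (2 ^ (s + 4) + 3) + 1) ≤ 2 * 2 ^ n + n := by
    rw [Finset.sum_add_distrib]
    simp only [Finset.sum_const, Finset.card_range, smul_eq_mul, mul_one]
    refine Nat.add_le_add_right (le_trans (Finset.sum_le_sum fun s hs => ?_)
      (sum_two_pow_sub_le n)) n
    have hs' : s ≤ n := (Finset.mem_range.mp hs).le
    apply Nat.div_le_of_le_mul
    calc 2 ^ (n + 4) = 2 ^ (s + 4) * 2 ^ (n - s) := by rw [← pow_add]; congr 1; omega
      _ ≤ (2 ^ (s + 4) + 3) * 2 ^ (n - s) := Nat.mul_le_mul_right _ (by omega)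
  have h2 : n < 2 ^ n := Nat.lt_two_pow_self
  have h3 : 2 ^ 2 ≤ 2 ^ n := Nat.pow_le_pow_right (by omega) hn
  have h4 : 2 ^ (n + 4) = 16 * 2 ^ n := by rw [pow_add]; ring
  rw [Finset.sum_range_succ', Finset.sum_range_succ', Finset.sum_range_succ',
    Finset.sum_range_succ']
  norm_num only at h1 ⊢
  simp only [add_assoc, Nat.reduceAdd] at h1 ⊢
  rw [h4] at h1 ⊢
  generalize ∑ s ∈ Finset.range n, (16 * 2 ^ n / (2 ^ (s + 4) + 3) + 1) = T at *
  generalize 2 ^ n = N at *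
  omega

open Classical in
/-- Every long window contains two positions at which no run of short period ends. -/
theorem exists_two_not_runEndsAt (x : ℤ → A) (m : ℤ) (n : ℕ) (hn : 2 ≤ n) :
    ∃ e₁ e₂ : ℤ, m ≤ e₁ ∧ e₁ < e₂ ∧ e₂ < m + 2 ^ (n + 4) ∧
      ∀ p : ℤ, 0 < p → p < 2 ^ (n + 4) → ¬ RunEndsAt x p e₁ ∧ ¬ RunEndsAt x p e₂ := by
  set S := n + 4 with hS
  let I : Finset ℤ := Finset.Ico m (m + (2 ^ S : ℕ))
  let B : ℕ → Finset ℤ := fun s =>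
    I.filter (fun e => ∃ p : ℤ, (2 : ℤ) ^ s ≤ p ∧ p < 2 * 2 ^ s ∧ RunEndsAt x p e)
  have hB : ∀ s, (B s).card ≤ 2 ^ S / (2 ^ s + 3) + 1 := by
    intro s
    apply card_le_of_separated (B s) m (2 ^ S) (2 ^ s + 3) (by positivity)
    · intro e he
      have := (Finset.mem_filter.mp he).1
      exact Finset.mem_Ico.mp this
    · intro e he e' he' hlt
      obtain ⟨p, h1, h2, h3⟩ := (Finset.mem_filter.mp he).2
      obtain ⟨p', h1', h2', h3'⟩ := (Finset.mem_filter.mp he').2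
      have := RunEndsAt.separated (P := 2 ^ s) (by positivity) h1 h2 h1' h2' h3 h3' hlt
      push_cast
      exact this
  let G : Finset ℤ := I \ (Finset.range S).biUnion B
  have hG : 1 < G.card := by
    have h1 : ((Finset.range S).biUnion B).card ≤
        ∑ s ∈ Finset.range S, (2 ^ S / (2 ^ s + 3) + 1) :=
      Finset.card_biUnion_le.trans (Finset.sum_le_sum fun s _ => hB s)
    have h2 := sum_two_pow_div_le n hn
    have h3 := Finset.le_card_sdiff ((Finset.range S).biUnion B) I
    have h4 : I.card = 2 ^ S := by
      rw [Int.card_Ico, add_sub_cancel_left, Int.toNat_natCast]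
    rw [h4] at h3
    change _ ≤ G.card at h3
    rw [← hS] at h2
    omega
  have hgood : ∀ e ∈ G, ∀ p : ℤ, 0 < p → p < 2 ^ S → ¬ RunEndsAt x p e := by
    intro e he p hp hpS hrun
    obtain ⟨heI, heB⟩ := Finset.mem_sdiff.mp he
    apply heB
    obtain ⟨q, rfl⟩ := Int.eq_ofNat_of_zero_le hp.le
    have hq : q ≠ 0 := by omega
    have hqS : q < 2 ^ S := by exact_mod_cast hpS
    refine Finset.mem_biUnion.mpr ⟨Nat.log 2 q, Finset.mem_range.mpr
      (Nat.log_lt_of_lt_pow hq hqS), Finset.mem_filter.mpr ⟨heI, q, ?_, ?_, hrun⟩⟩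
    · exact_mod_cast Nat.pow_log_le_self 2 hq
    · have := Nat.lt_pow_succ_log_self (b := 2) (by omega) q
      rw [pow_succ, mul_comm] at this
      exact_mod_cast this
  obtain ⟨a, ha, b, hb, hab⟩ := Finset.one_lt_card.mp hG
  have hI : ∀ e ∈ G, m ≤ e ∧ e < m + 2 ^ S := by
    intro e he
    have := Finset.mem_Ico.mp (Finset.mem_sdiff.mp he).1
    push_cast at this
    exact this
  rcases lt_or_gt_of_ne hab with h | h
  · exact ⟨a, b, (hI a ha).1, h, (hI b hb).2, fun p h1 h2 => ⟨hgood a ha p h1 h2, hgood b hb p h1 h2⟩⟩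
  · exact ⟨b, a, (hI b hb).1, h, (hI a ha).2, fun p h1 h2 => ⟨hgood b hb p h1 h2, hgood a ha p h1 h2⟩⟩

/-- An interval `[i, j]` containing `[0, m)` on both of whose sides `x` can be cut: no run of
exponent more than four ends at `j` or starts at `i`, and `[i, j]` is not a run of exponent more
than three. -/
theorem exists_cut (x : ℤ → A) (m : ℕ) :
    ∃ i j : ℤ, i < 0 ∧ m ≤ j ∧
      (∀ p, 0 < p → i ≤ j - 4 * p → PeriodicOn x p (j - 4 * p) j → x (j + 1) = x (j + 1 - p)) ∧
      (∀ p, 0 < p → i + 4 * p ≤ j → PeriodicOn x p i (i + 4 * p) → x (i - 1) = x (i - 1 + p)) ∧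
      (∀ p, 0 < p → i + 3 * p < j → PeriodicOn x p i j → x (i - 1) = x (i - 1 + p)) := by
  obtain ⟨n, hn, hmn⟩ : ∃ n : ℕ, 2 ≤ n ∧ m < 2 ^ (n + 4) :=
    ⟨m + 2, by omega, lt_of_lt_of_le Nat.lt_two_pow_self (Nat.pow_le_pow_right (by omega) (by omega))⟩
  have hmn' : (m : ℤ) < 2 ^ (n + 4) := by exact_mod_cast hmn
  -- These windows give `j - i < 3N`, where `N = 2 ^ (n + 4)`, so `i + 4p ≤ j` forces `p < N`.
  obtain ⟨j, j', hj1, hjj, hj2, hj⟩ := exists_two_not_runEndsAt x (2 ^ (n + 4)) n hn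
  obtain ⟨e₁, e₂, he1, hee, he2, he⟩ := exists_two_not_runEndsAt (fun t => x (0 - t)) 1 n hn
  generalize (2 : ℤ) ^ (n + 4) = N at *
  have hR : ∀ p, 0 < p → p < N → PeriodicOn x p (j - 4 * p) j → x (j + 1) = x (j + 1 - p) := by
    intro p hp hpN hper
    by_contra hne
    exact (hj p hp hpN).1 ⟨hper, hne⟩
  have hL : ∀ e, (e = e₁ ∨ e = e₂) → ∀ p, 0 < p → p < N → PeriodicOn x p (-e) (-e + 4 * p) →
      x (-e - 1) = x (-e - 1 + p) := by
    intro e hee p hp hpN hper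
    by_contra hne
    have hrun : RunEndsAt (fun t => x (0 - t)) p e := by
      refine ⟨?_, ?_⟩
      · have := hper.reflect 0
        rwa [show (0 : ℤ) - (-e + 4 * p) = e - 4 * p by ring, show (0 : ℤ) - -e = e by ring] at this
      · simp only
        rwa [show (0 : ℤ) - (e + 1) = -e - 1 by ring, show (0 : ℤ) - (e + 1 - p) = -e - 1 + p by ring]
    rcases hee with rfl | rfl
    · exact (he p hp hpN).1 hrun
    · exact (he p hp hpN).2 hrun
  by_cases hbad : ∀ p, 0 < p → -e₂ + 3 * p < j → PeriodicOn x p (-e₂) j →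
      x (-e₂ - 1) = x (-e₂ - 1 + p)
  · exact ⟨-e₂, j, by omega, by omega, fun p hp h1 => hR p hp (by omega),
      fun p hp h1 => hL e₂ (Or.inr rfl) p hp (by omega), hbad⟩
  -- If `-e₂` fails, the block from `-e₂` has a period `p`; it covers `-e₁ - 1`, and commuting `p`
  -- with `q` extends any period `q` of the shorter block.
  · refine ⟨-e₁, j, by omega, by omega, fun p hp h1 => hR p hp (by omega),
      fun p hp h1 => hL e₁ (Or.inl rfl) p hp (by omega), ?_⟩
    push Not at hbad
    obtain ⟨p, hp, hlen, hper, -⟩ := hbad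
    intro q hq hlenq hperq
    have f1 := hper (-e₁ - 1) (by omega) (by omega)
    have f2 := hperq (-e₁ - 1 + p) (by omega) (by omega)
    have f3 := hper (-e₁ - 1 + q) (by omega) (by omega)
    rw [f1, f2, f3]
    congr 1
    ring

end Runs

/-! ### Replacing the tails, and gluing -/

section Cut

/-- The word `x` on `[i, j]`, continued by `τ` on the right and by `σ` on the left. -/
def splice {A : Type*} (σ : ℕ → A) (x : ℤ → A) (τ : ℕ → A) (i j : ℤ) (n : ℤ) : A :=
  if n < i then σ (i - 1 - n).toNat else if n ≤ j then x n else τ (n - (j + 1)).toNat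

variable {A : Type*} {σ τ : ℕ → A} {x : ℤ → A} {i j : ℤ}

theorem splice_left {n : ℤ} (h : n < i) : splice σ x τ i j n = σ (i - 1 - n).toNat := by
  simp [splice, h]

theorem splice_mid {n : ℤ} (h : i ≤ n) (h' : n ≤ j) : splice σ x τ i j n = x n := by
  simp [splice, h, h']

theorem splice_right {n : ℤ} (hij : i ≤ j) (h : j < n) :
    splice σ x τ i j n = τ (n - (j + 1)).toNat := by
  simp [splice, not_le.mpr h, show ¬ n < i by omega]

theorem splice_right_overlap (hij : i ≤ j)
    (hτ : ∀ p, 0 < p → ∀ s, ¬ ∀ n, n ≤ p → τ (s + n) = τ (s + n + p)) {a b p : ℤ} (hp : 0 < p)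
    (ha : j < a) (h : PeriodicOn (splice σ x τ i j) p a b) : b - a + 1 ≤ 2 * p := by
  by_contra! hcon
  refine hτ p.toNat (by omega) (a - (j + 1)).toNat fun n hn => ?_
  have := h (a + n) (by omega) (by omega)
  rw [splice_right hij (by omega), splice_right hij (by omega)] at this
  convert this using 2 <;> omega

theorem splice_left_overlap
    (hσ : ∀ p, 0 < p → ∀ s, ¬ ∀ n, n ≤ p → σ (s + n) = σ (s + n + p)) {a b p : ℤ} (hp : 0 < p)
    (hb : b < i) (h : PeriodicOn (splice σ x τ i j) p a b) : b - a + 1 ≤ 2 * p := by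
  by_contra! hcon
  refine hσ p.toNat (by omega) (i - 1 - b).toNat fun n hn => ?_
  have := h (b - n - p) (by omega) (by omega)
  rw [splice_left (by omega), splice_left (by omega)] at this
  symm
  convert this using 2 <;> omega

/-- Otherwise the letter `x j` would recur at `j + p`, inside the tail that omits it. -/
theorem splice_right_lt (hij : i ≤ j) (hτ : ∀ n, τ n ≠ x j) {a b p : ℤ} (hp : 0 < p) (ha : a ≤ j)
    (h : PeriodicOn (splice σ x τ i j) p a b) : b - j < p := by
  by_contra! hcon
  have := h j ha (by omega)
  rw [splice_mid hij le_rfl, splice_right hij (by omega)] at this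
  exact hτ _ this.symm

theorem splice_left_lt (hij : i ≤ j) (hσ : ∀ n, σ n ≠ x i) {a b p : ℤ} (hp : 0 < p) (hb : i ≤ b)
    (h : PeriodicOn (splice σ x τ i j) p a b) : i - a < p := by
  by_contra! hcon
  have := h (i - p) (by omega) (by omega)
  rw [show i - p + p = i by ring, splice_mid le_rfl hij, splice_left (by omega)] at this
  exact hσ _ this

theorem splice_avoidsPowers {α : ℚ} (hα : 5 ≤ α) (hx : AvoidsPowers α x) (hij : i ≤ j)
    (hσ0 : σ 0 ≠ x (i - 1)) (hτ0 : τ 0 ≠ x (j + 1))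
    (hσ1 : ∀ n, σ n ≠ x i) (hτ1 : ∀ n, τ n ≠ x j)
    (hσ : ∀ p, 0 < p → ∀ s, ¬ ∀ n, n ≤ p → σ (s + n) = σ (s + n + p))
    (hτ : ∀ p, 0 < p → ∀ s, ¬ ∀ n, n ≤ p → τ (s + n) = τ (s + n + p))
    (hj : ∀ p, 0 < p → i ≤ j - 4 * p → PeriodicOn x p (j - 4 * p) j → x (j + 1) = x (j + 1 - p))
    (hi : ∀ p, 0 < p → i + 4 * p ≤ j → PeriodicOn x p i (i + 4 * p) → x (i - 1) = x (i - 1 + p))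
    (hboth : ∀ p, 0 < p → i + 3 * p < j → PeriodicOn x p i j → x (i - 1) = x (i - 1 + p)) :
    AvoidsPowers α (splice σ x τ i j) := by
  intro a b p hp hlen hper
  have h5 : 5 * p ≤ b - a + 1 := by
    have h1 : (5 : ℚ) * p ≤ α * p :=
      mul_le_mul_of_nonneg_right hα (by exact_mod_cast hp.le)
    exact_mod_cast h1.trans hlen
  have hmid : ∀ a' b', a ≤ a' → i ≤ a' → b' ≤ b → b' ≤ j → PeriodicOn x p a' b' :=
    fun a' b' h1 h2 h3 h4 => (hper.mono h1 h3).congr hp.le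
      fun n h5 h6 => splice_mid (by omega) (by omega)
  have hleft : a < i → i + p - 1 ≤ j → i + p - 1 ≤ b → x (i - 1) ≠ x (i - 1 + p) := by
    intro h1 h2 h3 heq
    have := hper (i - 1) (by omega) (by omega)
    rw [splice_left (by omega), splice_mid (by omega) (by omega), ← heq] at this
    apply hσ0
    rw [← this]
    congr 1
    omega
  by_cases hA : j < a
  · have := splice_right_overlap hij hτ hp hA hper
    omega
  by_cases hB : b < i
  · have := splice_left_overlap hσ hp hB hper
    omega
  push Not at hA hB
  have hr := splice_right_lt hij hτ1 hp hA hper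
  have hl := splice_left_lt hij hσ1 hp hB hper
  by_cases hai : a < i
  · by_cases hbj : j < b
    · exact hleft hai (by omega) (by omega)
        (hboth p hp (by omega) (hmid i j hai.le le_rfl hbj.le le_rfl))
    · exact hleft hai (by omega) (by omega)
        (hi p hp (by omega) (hmid i (i + 4 * p) hai.le le_rfl (by omega) (by omega)))
  · by_cases hbj : j < b
    · have h1 := hj p hp (by omega) (hmid (j - 4 * p) j (by omega) (by omega) hbj.le le_rfl)
      have h2 := hper (j + 1 - p) (by omega) (by omega)
      rw [show j + 1 - p + p = j + 1 by ring, splice_mid (by omega) (by omega),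
        splice_right hij (by omega), ← h1] at h2
      apply hτ0
      rw [h2]
      congr 1
      omega
    · exact hx a b p hp hlen (hmid a b le_rfl (by omega) le_rfl (by omega))

/-- A finite factor of a bi-infinite word avoiding `α`-powers also occurs in such a word in which
repetitions ending far to the right have exponent less than `5 / 2`. -/
theorem exists_tame_right {k : ℕ} {α : ℚ} (hk : 3 ≤ k) (hα : 5 ≤ α) {x : ℤ → Fin k}
    (hx : AvoidsPowers α x) (m : ℕ) :
    ∃ (y : ℤ → Fin k) (K : ℤ), AvoidsPowers α y ∧ (∀ n : ℤ, 0 ≤ n → n < m → y n = x n) ∧ m ≤ K ∧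
      ∀ a p, 0 < p → PeriodicOn y p a K → 2 * (K - a + 1) < 5 * p := by
  obtain ⟨i, j, hi0, hmj, hj, hi, hboth⟩ := exists_cut x m
  have hij : i ≤ j := by omega
  obtain ⟨s, hs1, hs2⟩ := exists_ne_ne hk (x (i - 1)) (x i)
  obtain ⟨t, ht1, ht2⟩ := exists_ne_ne hk (x (j + 1)) (x j)
  obtain ⟨σ, hσ0, hσ1, hσ⟩ := exists_overlap_free hk s (x i) hs2
  obtain ⟨τ, hτ0, hτ1, hτ⟩ := exists_overlap_free hk t (x j) ht2
  -- A repetition from the block to this endpoint has `2 * (j - i + 1) < p`, so its length is below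
  -- `p + p / 2 + p`.
  refine ⟨splice σ x τ i j, j + 2 * (j - i + 1), splice_avoidsPowers hα hx hij (hσ0 ▸ hs1)
    (hτ0 ▸ ht1) hσ1 hτ1 hσ hτ hj hi hboth, fun n h1 h2 => splice_mid (by omega) (by omega),
    by omega, fun a p hp hper => ?_⟩
  by_cases ha : j < a
  · have := splice_right_overlap hij hτ hp ha hper
    omega
  · have h1 := splice_right_lt hij hτ1 hp (by omega) hper
    have h2 := splice_left_lt hij hσ1 hp (by omega) hper
    omega

theorem AvoidsPowers.reflect {α : ℚ} (hx : AvoidsPowers α x) (c : ℤ) :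
    AvoidsPowers α (fun n => x (c - n)) := by
  intro a b p hp hlen hper
  refine hx (c - b) (c - a) p hp ?_ ?_
  · rwa [show c - a - (c - b) + 1 = b - a + 1 by ring]
  · have := hper.reflect c
    simpa using this

theorem AvoidsPowers.shift {α : ℚ} (hx : AvoidsPowers α x) (c : ℤ) :
    AvoidsPowers α (fun n => x (c + n)) := by
  have := (hx.reflect c).reflect 0
  simpa using this

/-- Two bi-infinite words avoiding `α`-powers can be glued where crossing repetitions are short
on both sides. -/
theorem glue_avoidsPowers {α : ℚ} (hα : 5 ≤ α) {y z : ℤ → A} (hy : AvoidsPowers α y)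
    (hz : AvoidsPowers α z) (K : ℤ)
    (hyK : ∀ a p, 0 < p → PeriodicOn y p a K → 2 * (K - a + 1) < 5 * p)
    (hzK : ∀ b p, 0 < p → PeriodicOn z p (K + 1) b → 2 * (b - K) < 5 * p) :
    AvoidsPowers α (fun n => if n ≤ K then y n else z n) := by
  intro a b p hp hlen hper
  have h5 : 5 * p ≤ b - a + 1 := by
    have h1 : (5 : ℚ) * p ≤ α * p :=
      mul_le_mul_of_nonneg_right hα (by exact_mod_cast hp.le)
    exact_mod_cast h1.trans hlen
  have hly : ∀ b', b' ≤ b → b' ≤ K → PeriodicOn y p a b' := fun b' h1 h2 =>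
    (hper.mono le_rfl h1).congr hp.le fun n h3 h4 => if_pos (by omega)
  have hrz : ∀ a', a ≤ a' → K < a' → PeriodicOn z p a' b := fun a' h1 h2 =>
    (hper.mono h1 le_rfl).congr hp.le fun n h3 h4 => if_neg (by omega)
  by_cases hb : b ≤ K
  · exact hy a b p hp hlen (hly b le_rfl hb)
  by_cases ha : K < a
  · exact hz a b p hp hlen (hrz a le_rfl ha)
  have h1 := hyK a p hp (hly K (by omega) le_rfl)
  have h2 := hzK b p hp (hrz (K + 1) (by omega) (by omega))
  omega

end Cut

end PowerFree

/-! ### Assembling the connecting word -/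

theorem mainTheorem2 (k : ℕ) (α : ℚ) (hk : 3 ≤ k) (hα : 5 ≤ α) :
    PowerFree.HasRestivoSalemiProperty (PowerFree.powerFreeLanguage k α) := by
  have hα0 : 0 < α := by linarith
  rintro u ⟨-, x, hx, a, hu⟩ v ⟨-, y, hy, b, hv⟩
  rw [PowerFree.mem_biInfinite_iff k α hα0] at hx hy
  obtain ⟨x', K, hx', hux, huK, hxK⟩ :=
    PowerFree.exists_tame_right hk hα (hx.shift a) u.length
  obtain ⟨y', J, hy', hvy, hvJ, hyJ⟩ :=
    PowerFree.exists_tame_right hk hα (hy.reflect (b + v.length - 1)) v.length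
  set z : ℤ → Fin k := fun n => if n ≤ K then x' n else y' (K + J + 1 - n) with hz
  have hzα : PowerFree.AvoidsPowers α z := by
    refine PowerFree.glue_avoidsPowers hα hx' (hy'.reflect (K + J + 1)) K hxK fun c p hp hper => ?_
    have h1 := hper.reflect (K + J + 1)
    simp only [sub_sub_cancel] at h1
    rw [show K + J + 1 - (K + 1) = J by ring] at h1
    have := hyJ _ p hp h1
    omega
  have hzmem := (PowerFree.mem_biInfinite_iff k α hα0 z).mpr hzα
  -- In `z`, `u` starts at `0` and `v` ends at `K + J + 1`; the bounds `huK` and `hvJ` keep this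
  -- difference positive.
  set d : ℕ := (K + J + 2 - v.length - u.length).toNat with hd
  refine ⟨List.ofFn (fun n : Fin d => z (u.length + (n : ℕ))), ?_⟩
  have hfac : u ++ List.ofFn (fun n : Fin d => z (u.length + (n : ℕ))) ++ v ∈
      PowerFree.factors z := by
    refine ⟨0, fun n hn => ?_⟩
    simp only [List.length_append, List.length_ofFn] at hn
    rcases lt_or_ge n u.length with h1 | h1
    · rw [List.getElem_append_left (by simp; omega), List.getElem_append_left h1, hu n h1]
      simp only [hz]
      rw [if_pos (by omega), hux _ (by omega) (by omega)]
      simp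
    rcases lt_or_ge n (u.length + d) with h2 | h2
    · rw [List.getElem_append_left (by simp; omega), List.getElem_append_right h1]
      simp only [List.getElem_ofFn]
      congr 1
      omega
    · rw [List.getElem_append_right (by simp; omega)]
      rw [hv _ (by simp; omega)]
      simp only [hz, List.length_append, List.length_ofFn]
      rw [if_neg (by omega), hvy _ (by omega) (by omega)]
      congr 1
      omega
  exact ⟨hzmem _ hfac, z, hzmem, hfac⟩
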